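/- Let $X$ be a finite-dimensional real symplectic vector space with symplectic form $\omega$. Let $\mathcal{L}(X)$ be its Lagrangian Grassmannian, the set of all Lagrangian subspaces of $X$, with its usual topology as a subspace of the Grassmannian. For $L, L' \in \mathcal{L}(X)$ put $d(L,L') = \dim L - \dim (L\cap L')$. The indexed Lagrangian Grassmannian is $\mathcal{L}_\bullet(X) = \mathcal{L}(X)\times \mathbb{Z}_{\ge 0}$, with levels $\mathcal{L}_k(X) = \mathcal{L}(X)\times\{k\}$. The sublevel of a point $(L,k)$ is $$S(L,k) = \{(L',j)\in \mathcal{L}_\bullet(X) : d(L,L') \le k-j\},$$ and $S(\mathcal{U}) = \bigcup_{p\in \mathcal{U}} S(p)$ for $\mathcal{U} \subseteq \mathcal{L}_\bullet(X)$. The Sabot topology on $\mathcal{L}_\bullet(X)$ is the topology generated by the sets $S(\mathcal{U})$, where $\mathcal{U}$ ranges over the open subsets of the levels $\mathcal{L}_k(X)$, $k\ge 0$. Let $C\subseteq X$ be a coisotropic subspace, i.e. $C^\perp\subseteq C$, where $\perp$ denotes the orthogonal with respect to $\omega$. Let $X^C = C/C^\perp$ be the reduced space with the symplectic form induced by $\omega$.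 For $L\in\mathcal{L}(X)$ let $L^C = (L\cap C)/(L\cap C^\perp)\in\mathcal{L}(X^C)$, that is, the image of $L\cap C$ in $C/C^\perp$, and let $\mathcal{E}^C(L) = \dim(L\cap C^\perp)$. Then the indexed reduction map $$\rho^C_\bullet : \mathcal{L}_\bullet(X)\to \mathcal{L}_\bullet(X^C),\qquad \rho^C_\bullet(L,k) = (L^C,\ k+\mathcal{E}^C(L)),$$ is continuous for the Sabot topologies on $\mathcal{L}_\bullet(X)$ and $\mathcal{L}_\bullet(X^C)$. -/

import Mathlib

namespace SympLin

open Module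

section Linear

variable {X : Type*} [AddCommGroup X] [Module ℝ X]

/-- A (linear) symplectic form: an alternating nondegenerate bilinear form. -/
structure IsSymplectic (ω : LinearMap.BilinForm ℝ X) : Prop where
  isAlt : ω.IsAlt
  nondegenerate : ω.Nondegenerate

/-- `L` is Lagrangian: it equals its symplectic orthogonal. -/
def IsLagrangian (ω : LinearMap.BilinForm ℝ X) (L : Submodule ℝ X) : Prop :=
  ω.orthogonal L = L

/-- `C` is coisotropic: it contains its symplectic orthogonal. -/
def IsCoisotropic (ω : LinearMap.BilinForm ℝ X) (C : Submodule ℝ X) : Prop :=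
  ω.orthogonal C ≤ C

/-- The set of Lagrangian subspaces of `(X, ω)`. -/
def LagrangianGrassmannian (ω : LinearMap.BilinForm ℝ X) : Type _ :=
  {L : Submodule ℝ X // IsLagrangian ω L}

/-- The usual topology on the set of all subspaces of a finite-dimensional real vector space `X`
(the disjoint union of the Grassmannians `Gr n X`): a set of subspaces is open iff, for every `n`,
the set of linearly independent `n`-tuples (frames) spanning a member of it is open in the space of
linearly independent `n`-tuples. Here `X` carries its canonical vector space topology, which for
finite-dimensional `X` is Mathlib's module topology. -/
@[reducible]
def subspaceTopology (X : Type*) [AddCommGroup X] [Module ℝ X] :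
    TopologicalSpace (Submodule ℝ X) :=
  letI : TopologicalSpace X := moduleTopology ℝ X
  ⨆ n : ℕ, TopologicalSpace.coinduced
    (fun f : {f : Fin n → X // LinearIndependent ℝ f} => Submodule.span ℝ (Set.range f.1))
    inferInstance

/-- The usual topology on the Lagrangian Grassmannian, as a subspace of the Grassmannian. -/
instance (ω : LinearMap.BilinForm ℝ X) : TopologicalSpace (LagrangianGrassmannian ω) :=
  TopologicalSpace.induced Subtype.val (subspaceTopology X)

/-- The discrete metric `d(L, L')`: the codimension of `L ∩ L'` in `L`. -/
noncomputable def lagrangianDist {ω : LinearMap.BilinForm ℝ X}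
    (L L' : LagrangianGrassmannian ω) : ℕ :=
  finrank ℝ (L.1 ⧸ (L.1 ⊓ L'.1).submoduleOf L.1)

/-- The indexed Lagrangian Grassmannian: pairs `(L, k)` of a Lagrangian subspace and a
nonnegative integer. Its topology is the Sabot topology below, not the product topology. -/
@[ext]
structure IndexedLagrangian (ω : LinearMap.BilinForm ℝ X) where
  lagr : LagrangianGrassmannian ω
  index : ℕ

/-- The sublevel `S(L, k)`: all `(L', j)` with `d(L, L') ≤ k - j` (an inequality of integers). -/
def sublevel {ω : LinearMap.BilinForm ℝ X} (p : IndexedLagrangian ω) :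
    Set (IndexedLagrangian ω) :=
  {q | (lagrangianDist p.lagr q.lagr : ℤ) ≤ (p.index : ℤ) - (q.index : ℤ)}

/-- The Sabot topology: generated by the sets `S(U × {k}) = ⋃ L ∈ U, S(L, k)`, where `k` is a
nonnegative integer and `U` is open in the Lagrangian Grassmannian. -/
instance sabotTopology (ω : LinearMap.BilinForm ℝ X) :
    TopologicalSpace (IndexedLagrangian ω) :=
  TopologicalSpace.generateFrom
    {s | ∃ (k : ℕ) (U : Set (LagrangianGrassmannian ω)), IsOpen U ∧
      s = ⋃ L ∈ U, sublevel ⟨L, k⟩}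

/-- The reduced space `X^C = C / C^⊥` (with `C^⊥` viewed inside `C`). -/
abbrev ReducedSpace (ω : LinearMap.BilinForm ℝ X) (C : Submodule ℝ X) : Type _ :=
  C ⧸ (ω.orthogonal C).submoduleOf C

/-- The bilinear form induced on `X^C` by `ω`: `([x], [y]) ↦ ω x y` for `x, y ∈ C`. -/
def reducedForm {ω : LinearMap.BilinForm ℝ X} (hω : IsSymplectic ω) (C : Submodule ℝ X) :
    LinearMap.BilinForm ℝ (ReducedSpace ω C) :=
  LinearMap.liftQ₂ ((ω.orthogonal C).submoduleOf C) ((ω.orthogonal C).submoduleOf C)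
    (ω.restrict C)
    (fun x hx => by
      rw [LinearMap.mem_ker]
      ext y
      exact hω.isAlt.isRefl _ _ (hx y.1 y.2))
    (fun y hy => by
      rw [LinearMap.mem_ker]
      ext x
      exact hy x.1 x.2)

@[simp]
theorem reducedForm_mk {ω : LinearMap.BilinForm ℝ X} (hω : IsSymplectic ω) (C : Submodule ℝ X)
    (x y : C) :
    reducedForm hω C (Submodule.Quotient.mk x) (Submodule.Quotient.mk y) = ω x.1 y.1 :=
  rfl

/-- The reduced space is again symplectic. -/
theorem isSymplectic_reducedForm {ω : LinearMap.BilinForm ℝ X} (hω : IsSymplectic ω)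
    (C : Submodule ℝ X) : IsSymplectic (reducedForm hω C) := by
  have halt : (reducedForm hω C).IsAlt := by
    intro x
    induction x using Submodule.Quotient.induction_on with
    | H x => exact hω.isAlt x.1
  refine ⟨halt, halt.isRefl.nondegenerate_iff_separatingRight.2 ?_⟩
  intro y hy
  induction y using Submodule.Quotient.induction_on with
  | H y =>
    rw [Submodule.Quotient.mk_eq_zero]
    intro x hx
    exact hy (Submodule.Quotient.mk ⟨x, hx⟩)

/-- The reduction `L^C = (L ∩ C) / (L ∩ C^⊥)`, i.e. the image of `L ∩ C` in `C / C^⊥`. -/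
def reduceSubspace (ω : LinearMap.BilinForm ℝ X) (C L : Submodule ℝ X) :
    Submodule ℝ (ReducedSpace ω C) :=
  (L.submoduleOf C).map ((ω.orthogonal C).submoduleOf C).mkQ

/-- The excess `E^C(L) = dim (L ∩ C^⊥)`. -/
noncomputable def excess (ω : LinearMap.BilinForm ℝ X) (C L : Submodule ℝ X) : ℕ :=
  finrank ℝ (L ⊓ ω.orthogonal C : Submodule ℝ X)

theorem isLagrangian_reduceSubspace [FiniteDimensional ℝ X] {ω : LinearMap.BilinForm ℝ X}
    (hω : IsSymplectic ω) {C : Submodule ℝ X} (hC : IsCoisotropic ω C)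
    {L : Submodule ℝ X} (hL : IsLagrangian ω L) :
    IsLagrangian (reducedForm hω C) (reduceSubspace ω C L) := by
  have hr := hω.isAlt.isRefl
  have hn := hω.nondegenerate
  have key : ω.orthogonal (L ⊓ C) ≤ L ⊔ ω.orthogonal C := by
    have h : ω.orthogonal (L ⊔ ω.orthogonal C) ≤ L ⊓ C := by
      refine le_inf ?_ ?_
      · exact (LinearMap.BilinForm.orthogonal_le le_sup_left).trans (le_of_eq hL)
      · exact (LinearMap.BilinForm.orthogonal_le le_sup_right).trans
          (le_of_eq (LinearMap.BilinForm.orthogonal_orthogonal hn hr C))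
    exact (LinearMap.BilinForm.orthogonal_le h).trans
      (le_of_eq (LinearMap.BilinForm.orthogonal_orthogonal hn hr _))
  apply le_antisymm
  · intro y hy
    induction y using Submodule.Quotient.induction_on with
    | H y =>
      have hy' : y.1 ∈ ω.orthogonal (L ⊓ C) := by
        intro x hx
        exact hy (Submodule.Quotient.mk ⟨x, hx.2⟩)
          (Submodule.mem_map.2 ⟨⟨x, hx.2⟩, hx.1, rfl⟩)
      obtain ⟨l, hl, c, hc, hlc⟩ := Submodule.mem_sup.1 (key hy')
      have hlC : l ∈ C := by
        rw [eq_sub_of_add_eq hlc]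
        exact C.sub_mem y.2 (hC hc)
      refine Submodule.mem_map.2 ⟨⟨l, hlC⟩, hl, ?_⟩
      refine (Submodule.Quotient.eq _).2 ?_
      change l - y.1 ∈ ω.orthogonal C
      rw [← hlc, sub_add_cancel_left]
      exact Submodule.neg_mem _ hc
  · rintro _ ⟨y, hy, rfl⟩ _ ⟨x, hx, rfl⟩
    have hy' : y.1 ∈ ω.orthogonal L := by rw [hL]; exact hy
    exact hy' x.1 hx

/-- The indexed reduction `ρ_•^C (L, k) = (L^C, k + E^C(L))`. -/
noncomputable def indexedReduction [FiniteDimensional ℝ X] {ω : LinearMap.BilinForm ℝ X}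
    (hω : IsSymplectic ω) {C : Submodule ℝ X} (hC : IsCoisotropic ω C)
    (p : IndexedLagrangian ω) : IndexedLagrangian (reducedForm hω C) where
  lagr := ⟨reduceSubspace ω C p.lagr.1, isLagrangian_reduceSubspace hω hC p.lagr.2⟩
  index := p.index + excess ω C p.lagr.1

end Linear

end SympLin

namespace SympLin

open Module

/-! ### Symplectic linear algebra and extension of isotropic subspaces. -/

section Lifting

variable {X : Type*} [AddCommGroup X] [Module ℝ X] {ω : LinearMap.BilinForm ℝ X}

/-! Continuity need only be tested on generators `S(V × {k})`, and the preimage of such a set is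
exactly `S(U × {k})`, where `U` consists of the Lagrangian `L` with `L ∩ C^⊥ = 0` and `L^C ∈ V`.
Only such `L` matter, although `L ↦ L^C` may be discontinuous elsewhere.

The equality of sets has two halves. Reduction is monotone: `d(L^C, L'^C) + E(L') ≤ d(L, L') +
E(L)`, by counting dimensions (`lagrangianDist_reduction_add_excess_le`). Conversely, given `L` and
a Lagrangian `M` of `X^C`, some lift `L₁` of `M` with `L₁ ∩ C^⊥ = 0` satisfies `d(L₁, L) ≤ d(M, L^C)
+ E(L)` (`exists_lift_lagrangianDist_le`); it is found by extending a suitable isotropic piece of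
`L`.

That `U` is open is a statement about frames: `L ∩ C^⊥ = 0` means that `L` is transverse to `C`, and
then a frame of `L ∩ C`, hence one of `L^C`, can be chosen locally as a continuous function of a
frame of `L` (`exists_continuous_frame_inf_ker`). -/

theorem orthogonal_sup (S T : Submodule ℝ X) :
    ω.orthogonal (S ⊔ T) = ω.orthogonal S ⊓ ω.orthogonal T := by
  refine le_antisymm (le_inf (LinearMap.BilinForm.orthogonal_le le_sup_left)
    (LinearMap.BilinForm.orthogonal_le le_sup_right)) ?_
  rintro x ⟨h1, h2⟩ y hy
  obtain ⟨s, hs, t, ht, rfl⟩ := Submodule.mem_sup.1 hy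
  have e1 : ω s x = 0 := h1 s hs
  have e2 : ω t x = 0 := h2 t ht
  change ω (s + t) x = 0
  rw [map_add, LinearMap.add_apply, e1, e2, add_zero]

theorem IsLagrangian.eq_of_le {L M : Submodule ℝ X} (hL : IsLagrangian ω L)
    (hM : IsLagrangian ω M) (h : L ≤ M) : L = M := by
  refine le_antisymm h ?_
  have := LinearMap.BilinForm.orthogonal_le (B := ω) h
  rwa [hL, hM] at this

variable [FiniteDimensional ℝ X]

theorem IsSymplectic.orthogonal_orthogonal (hω : IsSymplectic ω) (S : Submodule ℝ X) :
    ω.orthogonal (ω.orthogonal S) = S :=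
  LinearMap.BilinForm.orthogonal_orthogonal hω.nondegenerate hω.isAlt.isRefl S

theorem IsSymplectic.orthogonal_inf (hω : IsSymplectic ω) (S T : Submodule ℝ X) :
    ω.orthogonal (S ⊓ T) = ω.orthogonal S ⊔ ω.orthogonal T := by
  rw [← hω.orthogonal_orthogonal (ω.orthogonal S ⊔ ω.orthogonal T), orthogonal_sup,
    hω.orthogonal_orthogonal, hω.orthogonal_orthogonal]

theorem IsSymplectic.orthogonal_top (hω : IsSymplectic ω) : ω.orthogonal ⊤ = ⊥ := by
  rw [← hω.orthogonal_orthogonal ⊥, LinearMap.BilinForm.orthogonal_bot]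

theorem IsLagrangian.finrank_add_finrank (hω : IsSymplectic ω) {L : Submodule ℝ X}
    (hL : IsLagrangian ω L) : finrank ℝ L + finrank ℝ L = finrank ℝ X := by
  have h := LinearMap.BilinForm.finrank_orthogonal hω.nondegenerate L
  have h2 := Submodule.finrank_le L
  rw [hL] at h
  omega

theorem IsLagrangian.finrank_eq (hω : IsSymplectic ω) {L M : Submodule ℝ X}
    (hL : IsLagrangian ω L) (hM : IsLagrangian ω M) : finrank ℝ L = finrank ℝ M := by
  have := hL.finrank_add_finrank hω
  have := hM.finrank_add_finrank hω
  omega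

/-- A Lagrangian subspace is transverse to `C` iff it meets `C^⊥` trivially. -/
theorem IsLagrangian.sup_eq_top_iff (hω : IsSymplectic ω) {L : Submodule ℝ X}
    (hL : IsLagrangian ω L) (C : Submodule ℝ X) :
    L ⊔ C = ⊤ ↔ L ⊓ ω.orthogonal C = ⊥ := by
  have key : ω.orthogonal (L ⊔ C) = L ⊓ ω.orthogonal C := by rw [orthogonal_sup, hL]
  constructor
  · intro h
    rw [← key, h, hω.orthogonal_top]
  · intro h
    rw [← hω.orthogonal_orthogonal (L ⊔ C), key, h, LinearMap.BilinForm.orthogonal_bot]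

/-- Adding a vector orthogonal to an isotropic subspace keeps it isotropic. -/
theorem IsSymplectic.isotropic_sup_span (hω : IsSymplectic ω) {J : Submodule ℝ X}
    (hJ : J ≤ ω.orthogonal J) {x : X} (hx : x ∈ ω.orthogonal J) :
    J ⊔ ℝ ∙ x ≤ ω.orthogonal (J ⊔ ℝ ∙ x) := by
  have hxx : x ∈ ω.orthogonal (ℝ ∙ x) := by
    intro y hy
    obtain ⟨t, rfl⟩ := Submodule.mem_span_singleton.1 hy
    change ω (t • x) x = 0
    rw [map_smul, LinearMap.smul_apply, hω.isAlt x, smul_zero]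
  have hJx : J ≤ ω.orthogonal (ℝ ∙ x) := by
    have h : (ℝ ∙ x) ≤ ω.orthogonal J := (Submodule.span_singleton_le_iff_mem _ _).2 hx
    have := LinearMap.BilinForm.orthogonal_le (B := ω) h
    rwa [hω.orthogonal_orthogonal] at this
  rw [orthogonal_sup]
  exact sup_le (le_inf hJ hJx) ((Submodule.span_singleton_le_iff_mem _ _).2 ⟨hx, hxx⟩)

/-- An isotropic subspace `J` with `J ∩ C^⊥ = 0` whose intersection with `C` lies in a Lagrangian
subspace `N ⊆ C` extends to a Lagrangian subspace with the same properties. -/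
theorem IsSymplectic.exists_isLagrangian_ge (hω : IsSymplectic ω) {C N J : Submodule ℝ X}
    (hN : IsLagrangian ω N) (hNC : N ≤ C) (hJ : J ≤ ω.orthogonal J)
    (hJC : J ⊓ ω.orthogonal C = ⊥) (hJN : J ⊓ C ≤ N) :
    ∃ L, J ≤ L ∧ IsLagrangian ω L ∧ L ⊓ ω.orthogonal C = ⊥ ∧ L ⊓ C ≤ N := by
  -- A maximal `K` with these properties turns out to be Lagrangian: `hext` forbids adjoining any
  -- further vector of `K^⊥`.
  let P : Submodule ℝ X → Prop := fun K =>
    J ≤ K ∧ K ≤ ω.orthogonal K ∧ K ⊓ ω.orthogonal C = ⊥ ∧ K ⊓ C ≤ N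
  obtain ⟨K, ⟨hJK, hK, hKC, hKN⟩, hmax⟩ :=
    WellFounded.has_min (wellFounded_gt (α := Submodule ℝ X)) {K | P K} ⟨J, le_rfl, hJ, hJC, hJN⟩
  have hext : ∀ x ∈ ω.orthogonal K, x ∉ K → (K ⊔ ℝ ∙ x) ⊓ ω.orthogonal C = ⊥ →
      (K ⊔ ℝ ∙ x) ⊓ C ≤ N → False := by
    intro x hx hxK h1 h2
    refine hmax (K ⊔ ℝ ∙ x) ⟨hJK.trans le_sup_left, hω.isotropic_sup_span hK hx, h1, h2⟩ ?_
    refine lt_of_le_of_ne le_sup_left fun h => hxK ?_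
    rw [h]
    exact Submodule.mem_sup_right (Submodule.mem_span_singleton_self x)
  have hCC : ω.orthogonal C ≤ C := by
    refine (LinearMap.BilinForm.orthogonal_le hNC).trans ?_
    rwa [hN]
  -- Adjoining a vector outside `K + C` does not change the intersection with `C`, so maximality
  -- excludes it.
  have h1 : ω.orthogonal K ≤ K ⊔ C := by
    intro x hx
    by_contra hxC
    have hred : (K ⊔ ℝ ∙ x) ⊓ C ≤ K ⊓ C := by
      rintro y ⟨hy, hyC⟩
      obtain ⟨k, hk, z, hz, rfl⟩ := Submodule.mem_sup.1 hy
      obtain ⟨t, rfl⟩ := Submodule.mem_span_singleton.1 hz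
      rcases eq_or_ne t 0 with rfl | ht
      · rw [zero_smul, add_zero] at hyC ⊢
        exact ⟨hk, hyC⟩
      · exfalso
        apply hxC
        rw [← Submodule.smul_mem_iff _ ht]
        have : t • x = -k + (k + t • x) := by abel
        rw [this]
        exact Submodule.add_mem_sup (K.neg_mem hk) hyC
    refine hext x hx (fun h => hxC (Submodule.mem_sup_left h)) ?_ (hred.trans hKN)
    rw [← le_bot_iff, ← hKC]
    exact le_inf ((inf_le_inf_left _ hCC).trans (hred.trans inf_le_left)) inf_le_right
  have h2 : ω.orthogonal K ⊓ ω.orthogonal C = ⊥ := by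
    have := LinearMap.BilinForm.orthogonal_le (B := ω) h1
    rw [orthogonal_sup, hω.orthogonal_orthogonal] at this
    rw [← le_bot_iff, ← hKC]
    exact le_inf this inf_le_right
  -- A vector of `K^⊥ ∩ N` may also be adjoined: the sum stays in `K^⊥`, which meets `C^⊥` trivially
  -- by `h2`, and its part in `C` stays in `N`.
  have h3 : ω.orthogonal K ⊓ N ≤ K := by
    rintro x ⟨hx, hxN⟩
    by_contra hxK
    refine hext x hx hxK ?_ ?_
    · rw [← le_bot_iff, ← h2]
      exact inf_le_inf_right _ (sup_le hK ((Submodule.span_singleton_le_iff_mem _ _).2 hx))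
    · rintro y ⟨hy, hyC⟩
      obtain ⟨k, hk, z, hz, rfl⟩ := Submodule.mem_sup.1 hy
      have hzN : z ∈ N := (Submodule.span_singleton_le_iff_mem _ _).2 hxN hz
      refine N.add_mem (hKN ⟨hk, ?_⟩) hzN
      simpa using C.sub_mem hyC (hNC hzN)
  refine ⟨K, hJK, le_antisymm ?_ hK, hKC, hKN⟩
  -- This is `h3` dualized, using `N^⊥ = N`.
  have h4 : ω.orthogonal K ≤ K ⊔ N := by
    have := LinearMap.BilinForm.orthogonal_le (B := ω) h3
    rwa [hω.orthogonal_inf, hω.orthogonal_orthogonal, hN] at this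
  intro x hx
  obtain ⟨k, hk, z, hz, rfl⟩ := Submodule.mem_sup.1 (h4 hx)
  refine K.add_mem hk (h3 ⟨?_, hz⟩)
  simpa using Submodule.sub_mem _ hx (hK hk)

end Lifting

/-! ### Dimension counts for the reduction, and lifting of Lagrangians. -/

section Reduction

variable {X : Type*} [AddCommGroup X] [Module ℝ X] {ω : LinearMap.BilinForm ℝ X}

/-- A linear extension to `X` of the quotient map `C → C / C^⊥`. -/
theorem exists_extension_mkQ (ω : LinearMap.BilinForm ℝ X) (C : Submodule ℝ X) :
    ∃ q : X →ₗ[ℝ] ReducedSpace ω C, q ∘ₗ C.subtype = ((ω.orthogonal C).submoduleOf C).mkQ :=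
  LinearMap.exists_extend _

variable {C : Submodule ℝ X} {q : X →ₗ[ℝ] ReducedSpace ω C}

/-- Replaces subspaces of the subtype `C` by subspaces of `X`. The values of `q` off `C` are
arbitrary and never matter. -/
theorem reduceSubspace_eq_map (hq : q ∘ₗ C.subtype = ((ω.orthogonal C).submoduleOf C).mkQ)
    (L : Submodule ℝ X) : reduceSubspace ω C L = (L ⊓ C).map q := by
  rw [reduceSubspace, ← hq, Submodule.map_comp, inf_comm, ← Submodule.map_comap_subtype]
  rfl

theorem inf_ker_eq_inf_orthogonal
    (hq : q ∘ₗ C.subtype = ((ω.orthogonal C).submoduleOf C).mkQ)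
    {S : Submodule ℝ X} (hS : S ≤ C) : S ⊓ LinearMap.ker q = S ⊓ ω.orthogonal C := by
  ext x
  rw [Submodule.mem_inf, Submodule.mem_inf]
  refine and_congr_right fun hx => ?_
  have h := LinearMap.congr_fun hq ⟨x, hS hx⟩
  change q x = Submodule.Quotient.mk _ at h
  rw [LinearMap.mem_ker, h, Submodule.Quotient.mk_eq_zero]
  rfl

theorem finrank_map_add_finrank_inf_ker {V W : Type*} [AddCommGroup V] [Module ℝ V]
    [AddCommGroup W] [Module ℝ W] [FiniteDimensional ℝ V] (f : V →ₗ[ℝ] W) (S : Submodule ℝ V) :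
    finrank ℝ (S.map f) + finrank ℝ (S ⊓ LinearMap.ker f : Submodule ℝ V) = finrank ℝ S := by
  have h := LinearMap.finrank_range_add_finrank_ker (f ∘ₗ S.subtype)
  rw [LinearMap.range_comp, Submodule.range_subtype, LinearMap.ker_comp] at h
  rw [← h, ← Submodule.map_comap_subtype, Submodule.finrank_map_subtype_eq]

theorem finrank_map_add_finrank_inf_orthogonal [FiniteDimensional ℝ X]
    (hq : q ∘ₗ C.subtype = ((ω.orthogonal C).submoduleOf C).mkQ)
    {S : Submodule ℝ X} (hS : S ≤ C) :
    finrank ℝ (S.map q) + finrank ℝ (S ⊓ ω.orthogonal C : Submodule ℝ X) = finrank ℝ S := by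
  rw [← inf_ker_eq_inf_orthogonal hq hS, finrank_map_add_finrank_inf_ker]

theorem lagrangianDist_add_finrank_inf [FiniteDimensional ℝ X]
    (L L' : LagrangianGrassmannian ω) :
    lagrangianDist L L' + finrank ℝ (L.1 ⊓ L'.1 : Submodule ℝ X) = finrank ℝ L.1 := by
  have h := Submodule.finrank_quotient_add_finrank ((L.1 ⊓ L'.1).submoduleOf L.1)
  rwa [(Submodule.submoduleOfEquivOfLe (inf_le_left : L.1 ⊓ L'.1 ≤ L.1)).finrank_eq] at h

/-- The reduction of a Lagrangian subspace, as a point of the Lagrangian Grassmannian. -/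
def lagrangianReduction [FiniteDimensional ℝ X]
    (hω : IsSymplectic ω) (hC : IsCoisotropic ω C) (L : LagrangianGrassmannian ω) :
    LagrangianGrassmannian (reducedForm hω C) :=
  ⟨reduceSubspace ω C L.1, isLagrangian_reduceSubspace hω hC L.2⟩

/-- The image of `L ∩ L' ∩ C` lies in `L^C ∩ L'^C` and loses at most `E(L)` dimensions, while `L' ∩
C` and `L ∩ L'` both lie in `L'`, which bounds `dim (L ∩ L' ∩ C)` from below. -/
theorem lagrangianDist_reduction_add_excess_le [FiniteDimensional ℝ X]
    (hω : IsSymplectic ω) (hC : IsCoisotropic ω C) (L L' : LagrangianGrassmannian ω) :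
    lagrangianDist (lagrangianReduction hω hC L) (lagrangianReduction hω hC L') +
      excess ω C L'.1 ≤ lagrangianDist L L' + excess ω C L.1 := by
  obtain ⟨q, hq⟩ := exists_extension_mkQ ω C
  have e1 := lagrangianDist_add_finrank_inf L L'
  have e2 := lagrangianDist_add_finrank_inf (lagrangianReduction hω hC L)
    (lagrangianReduction hω hC L')
  have e3 : finrank ℝ (lagrangianReduction hω hC L).1 =
      finrank ℝ (lagrangianReduction hω hC L').1 :=
    (lagrangianReduction hω hC L).2.finrank_eq (isSymplectic_reducedForm hω C)
      (lagrangianReduction hω hC L').2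
  have e4 := L.2.finrank_eq hω L'.2
  have r : ∀ L, (lagrangianReduction hω hC L).1 = (L.1 ⊓ C).map q :=
    fun L => reduceSubspace_eq_map hq L.1
  have e5 := finrank_map_add_finrank_inf_orthogonal hq (inf_le_right : L'.1 ⊓ C ≤ C)
  have e6 := finrank_map_add_finrank_inf_orthogonal hq (inf_le_right : (L.1 ⊓ L'.1) ⊓ C ≤ C)
  have e7 : finrank ℝ ((L.1 ⊓ L'.1 ⊓ C).map q) ≤
      finrank ℝ ((lagrangianReduction hω hC L).1 ⊓ (lagrangianReduction hω hC L').1 :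
        Submodule ℝ (ReducedSpace ω C)) := by
    rw [r, r]
    exact Submodule.finrank_mono (le_inf
      (Submodule.map_mono (inf_le_inf_right _ inf_le_left))
      (Submodule.map_mono (inf_le_inf_right _ inf_le_right)))
  rw [r L'] at e3
  rw [inf_assoc, inf_eq_right.2 hC] at e5
  rw [inf_assoc (L.1 ⊓ L'.1), inf_eq_right.2 hC] at e6
  have e8 : finrank ℝ (L.1 ⊓ L'.1 ⊓ ω.orthogonal C : Submodule ℝ X) ≤ excess ω C L.1 :=
    Submodule.finrank_mono (inf_le_inf_right _ inf_le_left)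
  have e9 := Submodule.finrank_sup_add_finrank_inf_eq (L'.1 ⊓ C) (L.1 ⊓ L'.1)
  have e10 : finrank ℝ (L'.1 ⊓ C ⊔ L.1 ⊓ L'.1 : Submodule ℝ X) ≤ finrank ℝ L'.1 :=
    Submodule.finrank_mono (sup_le inf_le_left inf_le_right)
  have e11 : L'.1 ⊓ C ⊓ (L.1 ⊓ L'.1) = L.1 ⊓ L'.1 ⊓ C := by
    ext x; simp only [Submodule.mem_inf]; tauto
  rw [e11] at e9
  change _ + finrank ℝ (L'.1 ⊓ ω.orthogonal C : Submodule ℝ X) ≤ _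
  omega

/-- Every Lagrangian subspace `M` of the reduced space lifts to a Lagrangian subspace transverse
to `C` that is as close to a given `L` as monotonicity of the reduction allows. -/
theorem exists_lift_lagrangianDist_le [FiniteDimensional ℝ X]
    (hω : IsSymplectic ω) (hC : IsCoisotropic ω C) {L : Submodule ℝ X}
    (hL : IsLagrangian ω L) {M : Submodule ℝ (ReducedSpace ω C)}
    (hM : IsLagrangian (reducedForm hω C) M) :
    ∃ (L₁ : Submodule ℝ X) (hL₁ : IsLagrangian ω L₁), L₁ ⊓ ω.orthogonal C = ⊥ ∧
      reduceSubspace ω C L₁ = M ∧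
      lagrangianDist (ω := ω) ⟨L₁, hL₁⟩ ⟨L, hL⟩ ≤
        lagrangianDist ⟨M, hM⟩ (lagrangianReduction hω hC ⟨L, hL⟩) + excess ω C L := by
  obtain ⟨q, hq⟩ := exists_extension_mkQ ω C
  have hmk : ∀ c : C, q c.1 = Submodule.Quotient.mk c := LinearMap.congr_fun hq
  -- The full preimage of `M` in `C`: a Lagrangian with `C^⊥ ≤ N ≤ C`. It is itself a lift of `M`,
  -- but not a transverse one in general.
  let N : Submodule ℝ X := C ⊓ M.comap q
  have hCN : ω.orthogonal C ≤ N := by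
    intro x hx
    refine ⟨hC hx, ?_⟩
    have : x ∈ C ⊓ LinearMap.ker q := by
      rw [inf_ker_eq_inf_orthogonal hq le_rfl]
      exact ⟨hC hx, hx⟩
    change q x ∈ M
    rw [LinearMap.mem_ker.1 this.2]
    exact M.zero_mem
  have hN : IsLagrangian ω N := by
    apply le_antisymm
    · intro x hx
      have hxC : x ∈ C := by
        have := LinearMap.BilinForm.orthogonal_le (B := ω) hCN hx
        rwa [hω.orthogonal_orthogonal] at this
      refine ⟨hxC, ?_⟩
      change q x ∈ M
      rw [← hM, hmk ⟨x, hxC⟩]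
      intro y hy
      induction y using Submodule.Quotient.induction_on with
      | H y => exact hx y.1 ⟨y.2, by change q y.1 ∈ M; rwa [hmk]⟩
    · intro x hx y hy
      have hxM : q x ∈ (reducedForm hω C).orthogonal M := by rw [hM]; exact hx.2
      have := hxM (q y) hy.2
      rw [hmk ⟨x, hx.1⟩, hmk ⟨y, hy.1⟩] at this
      exact this
  -- `A ⊔ K` is the part of `L` to be kept in `L₁`: `A` drops `L ∩ C^⊥` from `L ∩ N`, and `K` is the
  -- part of `L` away from `C`. The loss of `L ∩ C^⊥` accounts for the excess term in the bound.
  obtain ⟨A, hAd, hAs⟩ : ∃ A, Disjoint A (L ⊓ ω.orthogonal C) ∧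
      A ⊔ (L ⊓ ω.orthogonal C) = L ⊓ N := by
    obtain ⟨A, hA⟩ := Submodule.exists_isCompl (L ⊓ ω.orthogonal C)
    refine ⟨A ⊓ (L ⊓ N), hA.symm.disjoint.mono_left inf_le_left, ?_⟩
    rw [sup_comm, ← sup_inf_assoc_of_le _ (inf_le_inf_left _ hCN), hA.sup_eq_top, top_inf_eq]
  obtain ⟨K, hKd, hKs⟩ : ∃ K, Disjoint K (L ⊓ C) ∧ K ⊔ (L ⊓ C) = L := by
    obtain ⟨K, hK⟩ := Submodule.exists_isCompl (L ⊓ C)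
    refine ⟨K ⊓ L, hK.symm.disjoint.mono_left inf_le_left, ?_⟩
    rw [sup_comm, ← sup_inf_assoc_of_le _ inf_le_left, hK.sup_eq_top, top_inf_eq]
  have hAN : A ≤ L ⊓ N := hAs ▸ le_sup_left
  have hKL : K ≤ L := le_sup_left.trans hKs.le
  have hAC : A ≤ L ⊓ C := hAN.trans (inf_le_inf_left _ inf_le_left)
  have hJL : A ⊔ K ≤ L := sup_le (hAN.trans inf_le_left) hKL
  have hJC : (A ⊔ K) ⊓ C ≤ A := by
    rw [sup_inf_assoc_of_le _ (hAC.trans inf_le_right)]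
    refine sup_le le_rfl ?_
    have : K ⊓ C ≤ ⊥ := hKd inf_le_left (le_inf (inf_le_left.trans hKL) inf_le_right)
    exact this.trans bot_le
  obtain ⟨L₁, hJL₁, hL₁, hL₁C, hL₁N⟩ := hω.exists_isLagrangian_ge (C := C) (J := A ⊔ K) hN
    inf_le_left (hJL.trans (hL.ge.trans (LinearMap.BilinForm.orthogonal_le hJL)))
    (by
      rw [← le_bot_iff]
      have h1 : (A ⊔ K) ⊓ ω.orthogonal C ≤ A := (inf_le_inf_left _ hC).trans hJC
      exact hAd h1 (le_inf (inf_le_left.trans hJL) inf_le_right))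
    (hJC.trans (hAN.trans inf_le_right))
  have hred : reduceSubspace ω C L₁ = M := by
    -- Both sides are Lagrangian, so the inclusion coming from `L₁ ∩ C ≤ N` suffices.
    refine IsLagrangian.eq_of_le (isLagrangian_reduceSubspace hω hC hL₁) hM ?_
    rw [reduceSubspace_eq_map hq, Submodule.map_le_iff_le_comap]
    exact hL₁N.trans inf_le_right
  refine ⟨L₁, hL₁, hL₁C, hred, ?_⟩
  have e1 := lagrangianDist_add_finrank_inf (ω := ω) ⟨L₁, hL₁⟩ ⟨L, hL⟩
  have e2 := lagrangianDist_add_finrank_inf ⟨M, hM⟩ (lagrangianReduction hω hC ⟨L, hL⟩)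
  have e3 := hM.finrank_eq (isSymplectic_reducedForm hω C) (isLagrangian_reduceSubspace hω hC hL)
  have e4 : finrank ℝ L₁ = finrank ℝ L := hL₁.finrank_eq hω hL
  have r : reduceSubspace ω C L = (L ⊓ C).map q := reduceSubspace_eq_map hq L
  have r2 : M ⊓ reduceSubspace ω C L = (L ⊓ N).map q := by
    rw [r, inf_comm, ← inf_assoc L C]
    ext y
    simp only [Submodule.mem_inf, Submodule.mem_map, Submodule.mem_comap]
    constructor
    · rintro ⟨⟨x, hx, rfl⟩, hy⟩
      exact ⟨x, ⟨hx, hy⟩, rfl⟩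
    · rintro ⟨x, ⟨hx, hy⟩, rfl⟩
      exact ⟨⟨x, hx, rfl⟩, hy⟩
  have e5 := finrank_map_add_finrank_inf_orthogonal hq (inf_le_right : L ⊓ C ≤ C)
  have e6 := finrank_map_add_finrank_inf_orthogonal hq
    (inf_le_right.trans inf_le_left : L ⊓ N ≤ C)
  rw [inf_assoc, inf_eq_right.2 hC] at e5
  rw [inf_assoc, inf_eq_right.2 hCN] at e6
  rw [r] at e3
  have e7 := Submodule.finrank_sup_add_finrank_inf_eq A (L ⊓ ω.orthogonal C)
  rw [hAs, hAd.eq_bot, finrank_bot] at e7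
  have e8 := Submodule.finrank_sup_add_finrank_inf_eq K (L ⊓ C)
  rw [hKs, hKd.eq_bot, finrank_bot] at e8
  have e9 := Submodule.finrank_sup_add_finrank_inf_eq A K
  rw [(hKd.symm.mono_left hAC).eq_bot, finrank_bot] at e9
  have e10 : finrank ℝ (A ⊔ K : Submodule ℝ X) ≤ finrank ℝ (L₁ ⊓ L : Submodule ℝ X) :=
    Submodule.finrank_mono (le_inf hJL₁ hJL)
  change _ + finrank ℝ (M ⊓ reduceSubspace ω C L : Submodule ℝ _) = finrank ℝ M at e2
  rw [r2] at e2
  change lagrangianDist _ _ + finrank ℝ (L₁ ⊓ L : Submodule ℝ X) = finrank ℝ L₁ at e1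
  change _ ≤ _ + finrank ℝ (L ⊓ ω.orthogonal C : Submodule ℝ X)
  omega

end Reduction

end SympLin

namespace SympLin

open Module

/-! ### Openness in the Grassmannian via continuous frames. -/

section Topology

open Topology

theorem isOpen_subspaceTopology_iff {X : Type*} [AddCommGroup X] [Module ℝ X]
    (S : Set (Submodule ℝ X)) :
    letI : TopologicalSpace X := moduleTopology ℝ X
    IsOpen[subspaceTopology X] S ↔ ∀ n : ℕ,
      IsOpen {f : {f : Fin n → X // LinearIndependent ℝ f} |
        Submodule.span ℝ (Set.range f.1) ∈ S} := by
  rw [subspaceTopology, isOpen_iSup_iff]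
  rfl

open Matrix in
/-- If `A * R` is a square matrix then `det (A * R) • 1 - R * adj (A * R) * A` has columns in the
kernel of `A`. -/
theorem mul_det_smul_sub_adjugate {m n : Type*} [Fintype m] [DecidableEq m] [Fintype n]
    [DecidableEq n] (A : Matrix m n ℝ) (R : Matrix n m ℝ) :
    A * ((A * R).det • (1 : Matrix n n ℝ) - R * (A * R).adjugate * A) = 0 := by
  rw [Matrix.mul_sub, Matrix.mul_smul, Matrix.mul_one, ← Matrix.mul_assoc, ← Matrix.mul_assoc,
    Matrix.mul_adjugate, Matrix.smul_mul, Matrix.one_mul, sub_self]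

variable {X Y : Type*} [AddCommGroup X] [Module ℝ X]

open Matrix in
/-- Frames of subspaces transverse to `ker T` yield, locally and continuously, frames of their
intersections with `ker T`. -/
theorem exists_continuous_frame_inf_ker [TopologicalSpace X] [IsModuleTopology ℝ X] {c n : ℕ}
    (T : X →ₗ[ℝ] (Fin c → ℝ)) {f₀ : Fin n → X} (hf₀ : LinearIndependent ℝ f₀)
    (hT : (Submodule.span ℝ (Set.range f₀)).map T = ⊤) :
    ∃ (p : ℕ) (g : (Fin n → X) → Fin p → X), Continuous g ∧ p + c = n ∧
      LinearIndependent ℝ (g f₀) ∧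
      (∀ f k, g f k ∈ Submodule.span ℝ (Set.range f) ⊓ LinearMap.ker T) ∧
      ∃ V ∈ 𝓝 f₀, ∀ f ∈ V, (Submodule.span ℝ (Set.range f)).map T = ⊤ := by
  have : ContinuousSMul ℝ X := IsModuleTopology.toContinuousSMul ℝ X
  have : ContinuousAdd X := IsModuleTopology.toContinuousAdd ℝ X
  let A : (Fin n → X) → Matrix (Fin c) (Fin n) ℝ := fun f => Matrix.of fun j i => T (f i) j
  have hA : Continuous A := by
    refine continuous_matrix fun j i => ?_
    exact (continuous_apply j).comp
      ((IsModuleTopology.continuous_of_linearMap T).comp (continuous_apply i))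
  have hAT : ∀ f, (Submodule.span ℝ (Set.range f)).map T = LinearMap.range (A f).mulVecLin := by
    intro f
    rw [Matrix.range_mulVecLin, Submodule.map_span, ← Set.range_comp]
    rfl
  have hTA : ∀ f (v : Fin n → ℝ), T (Fintype.linearCombination ℝ f v) = A f *ᵥ v := by
    intro f v
    ext j
    simp [Fintype.linearCombination_apply, A, Matrix.mulVec, dotProduct, mul_comm]
  have hsurj : LinearMap.range (A f₀).mulVecLin = ⊤ := by rw [← hAT, hT]
  obtain ⟨R, hR'⟩ := Matrix.mulVec_surjective_iff_exists_right_inverse.1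
    (LinearMap.range_eq_top.1 hsurj)
  have hR : A f₀ * R = 1 := hR'
  -- `P f` maps into `ker (A f)` and fixes `ker (A f₀)` pointwise at `f = f₀`. Using the adjugate
  -- instead of an inverse keeps it continuous for every `f`.
  let P : (Fin n → X) → Matrix (Fin n) (Fin n) ℝ := fun f =>
    (A f * R).det • (1 : Matrix (Fin n) (Fin n) ℝ) - R * (A f * R).adjugate * A f
  have hP : Continuous P := by fun_prop
  have hAR : Continuous fun f => (A f * R).det := by fun_prop
  let v := finBasis ℝ (LinearMap.ker (A f₀).mulVecLin)
  have hv : ∀ k, A f₀ *ᵥ (v k).1 = 0 := fun k => (v k).2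
  refine ⟨_, fun f k => Fintype.linearCombination ℝ f (P f *ᵥ (v k).1), ?_, ?_, ?_, ?_,
    {f | (A f * R).det ≠ 0}, ?_, ?_⟩
  · simp only [Fintype.linearCombination_apply]
    fun_prop
  · have h := LinearMap.finrank_range_add_finrank_ker (A f₀).mulVecLin
    rw [hsurj, finrank_top, finrank_fin_fun, finrank_fin_fun] at h
    omega
  · have hPv : ∀ k, P f₀ *ᵥ (v k).1 = (v k).1 := by
      intro k
      simp only [P, hR, Matrix.sub_mulVec, ← Matrix.mulVec_mulVec, hv, Matrix.mulVec_zero,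
        Matrix.det_one, one_smul, Matrix.one_mulVec, sub_zero]
    simp only [hPv]
    have h1 : LinearIndependent ℝ fun k => (v k).1 :=
      v.linearIndependent.map' (Submodule.subtype _) (Submodule.ker_subtype _)
    exact h1.map' (Fintype.linearCombination ℝ f₀)
      (LinearMap.ker_eq_bot.2 hf₀.fintypeLinearCombination_injective)
  · intro f k
    refine ⟨?_, ?_⟩
    · rw [← Fintype.range_linearCombination]
      exact LinearMap.mem_range_self _ _
    · change T _ = 0
      rw [hTA, Matrix.mulVec_mulVec, mul_det_smul_sub_adjugate, Matrix.zero_mulVec]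
  · refine (isOpen_ne.preimage hAR).mem_nhds ?_
    change (A f₀ * R).det ≠ 0
    rw [hR, Matrix.det_one]
    exact one_ne_zero
  · intro f hf
    rw [hAT, LinearMap.range_eq_top]
    refine Matrix.mulVec_surjective_iff_exists_right_inverse.2 ⟨R * (A f * R)⁻¹, ?_⟩
    rw [← Matrix.mul_assoc, Matrix.mul_nonsing_inv _ (isUnit_iff_ne_zero.2 hf)]

variable [FiniteDimensional ℝ X] [AddCommGroup Y] [Module ℝ Y] [FiniteDimensional ℝ Y]

/-- Near a given frame, `q ∘ g f` depends continuously on `f` and stays independent, so it is a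
frame of the image to which openness of `W` applies. -/
theorem isOpen_setOf_map_inf_ker_mem [TopologicalSpace X] [IsModuleTopology ℝ X] {c n : ℕ}
    (T : X →ₗ[ℝ] (Fin c → ℝ)) (q : X →ₗ[ℝ] Y) {W : Set (Submodule ℝ Y)}
    (hW : IsOpen[subspaceTopology Y] W) :
    IsOpen {f : {f : Fin n → X // LinearIndependent ℝ f} |
      (Submodule.span ℝ (Set.range f.1)).map T = ⊤ ∧
      (Submodule.span ℝ (Set.range f.1) ⊓ LinearMap.ker T) ⊓ LinearMap.ker q = ⊥ ∧
      (Submodule.span ℝ (Set.range f.1) ⊓ LinearMap.ker T).map q ∈ W} := by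
  let : TopologicalSpace Y := moduleTopology ℝ Y
  have : IsModuleTopology ℝ Y := ⟨rfl⟩
  have : ContinuousAdd Y := IsModuleTopology.toContinuousAdd ℝ Y
  have : ContinuousSMul ℝ Y := IsModuleTopology.toContinuousSMul ℝ Y
  rw [isOpen_iff_mem_nhds]
  rintro ⟨f₀, hf₀⟩ ⟨h1, h2, h3⟩
  obtain ⟨p, g, hg, hp, hg₀, hgm, V, hV, hVT⟩ := exists_continuous_frame_inf_ker T hf₀ h1
  have hdim : ∀ f : Fin n → X, LinearIndependent ℝ f →
      (Submodule.span ℝ (Set.range f)).map T = ⊤ →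
      finrank ℝ (Submodule.span ℝ (Set.range f) ⊓ LinearMap.ker T : Submodule ℝ X) = p := by
    intro f hf hfT
    have h := finrank_map_add_finrank_inf_ker T (Submodule.span ℝ (Set.range f))
    rw [hfT, finrank_span_eq_card hf, finrank_top, finrank_fin_fun, Fintype.card_fin] at h
    omega
  -- Independence of `p` vectors in the image of a `p`-dimensional space forces both injectivity of
  -- `q` there and spanning.
  have hspan : ∀ f : Fin n → X, LinearIndependent ℝ f →
      (Submodule.span ℝ (Set.range f)).map T = ⊤ → LinearIndependent ℝ (q ∘ g f) →
      (Submodule.span ℝ (Set.range f) ⊓ LinearMap.ker T) ⊓ LinearMap.ker q = ⊥ ∧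
      Submodule.span ℝ (Set.range (q ∘ g f)) =
        (Submodule.span ℝ (Set.range f) ⊓ LinearMap.ker T).map q := by
    intro f hf hfT hqg
    have e1 := finrank_map_add_finrank_inf_ker q
      (Submodule.span ℝ (Set.range f) ⊓ LinearMap.ker T)
    have e2 := finrank_span_eq_card hqg
    rw [Fintype.card_fin] at e2
    have hle : Submodule.span ℝ (Set.range (q ∘ g f)) ≤
        (Submodule.span ℝ (Set.range f) ⊓ LinearMap.ker T).map q := by
      rw [Submodule.span_le]
      rintro _ ⟨k, rfl⟩
      exact Submodule.mem_map_of_mem (hgm f k)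
    have e3 := Submodule.finrank_mono hle
    rw [hdim f hf hfT] at e1
    refine ⟨Submodule.finrank_eq_zero.1 (by omega), Submodule.eq_of_le_of_finrank_le hle ?_⟩
    omega
  have hqg₀ : LinearIndependent ℝ (q ∘ g f₀) := by
    refine hg₀.map ?_
    rw [disjoint_iff, ← le_bot_iff, ← h2]
    refine inf_le_inf_right _ (Submodule.span_le.2 ?_)
    rintro _ ⟨k, rfl⟩
    exact hgm f₀ k
  have hcont : Continuous fun f : {f : Fin n → X // LinearIndependent ℝ f} => q ∘ g f.1 := by
    refine continuous_pi fun k => ?_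
    exact (IsModuleTopology.continuous_of_linearMap q).comp
      ((continuous_apply k).comp (hg.comp continuous_subtype_val))
  have hopen : IsOpen {y : Fin p → Y | LinearIndependent ℝ y} := by
    let e := (finBasis ℝ Y).equivFun
    have he : Continuous fun y : Fin p → Y => (e ∘ y : Fin p → Fin (finrank ℝ Y) → ℝ) :=
      continuous_pi fun k =>
        (IsModuleTopology.continuous_of_linearMap e.toLinearMap).comp (continuous_apply k)
    have := (isOpen_setOfPred_linearIndependent (𝕜 := ℝ) (ι := Fin p)
      (E := Fin (finrank ℝ Y) → ℝ)).preimage he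
    convert this using 1
    ext y
    exact (LinearMap.linearIndependent_iff e.toLinearMap e.ker).symm
  have hWp := (isOpen_subspaceTopology_iff W).1 hW p
  obtain ⟨O, hO, hOW⟩ := isOpen_induced_iff.1 hWp
  have hOmem : ∀ y : Fin p → Y, LinearIndependent ℝ y →
      (y ∈ O ↔ Submodule.span ℝ (Set.range y) ∈ W) := by
    intro y hy
    exact Set.ext_iff.1 hOW ⟨y, hy⟩
  have n1 : ∀ᶠ f in 𝓝 (⟨f₀, hf₀⟩ : {f : Fin n → X // LinearIndependent ℝ f}), f.1 ∈ V :=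
    continuous_subtype_val.continuousAt.eventually_mem hV
  have hat := hcont.continuousAt (x := ⟨f₀, hf₀⟩)
  have n2 := hat.eventually_mem (hopen.mem_nhds hqg₀)
  have n3 := hat.eventually_mem
    (hO.mem_nhds ((hOmem _ hqg₀).2 (by rwa [(hspan f₀ hf₀ h1 hqg₀).2])))
  filter_upwards [n1, n2, n3] with f m1 m2 m3
  have hfT := hVT f.1 m1
  obtain ⟨s1, s2⟩ := hspan f.1 f.2 hfT m2
  exact ⟨hfT, s1, s2 ▸ (hOmem _ m2).1 m3⟩

/-- On the subspaces `L` transverse to `C` on whose intersection with `C` a linear map `q` is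
injective, `L ↦ q (L ∩ C)` pulls open sets back to open sets. -/
theorem isOpen_setOf_map_inf_mem (C : Submodule ℝ X) (q : X →ₗ[ℝ] Y) {W : Set (Submodule ℝ Y)}
    (hW : IsOpen[subspaceTopology Y] W) :
    IsOpen[subspaceTopology X]
      {L | L ⊔ C = ⊤ ∧ (L ⊓ C) ⊓ LinearMap.ker q = ⊥ ∧ (L ⊓ C).map q ∈ W} := by
  rw [isOpen_subspaceTopology_iff]
  intro n
  let := moduleTopology ℝ X
  have : IsModuleTopology ℝ X := ⟨rfl⟩
  let T : X →ₗ[ℝ] (Fin (finrank ℝ (X ⧸ C)) → ℝ) :=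
    (finBasis ℝ (X ⧸ C)).equivFun.toLinearMap ∘ₗ C.mkQ
  have hker : LinearMap.ker T = C := by
    rw [LinearEquiv.ker_comp, Submodule.ker_mkQ]
  have hrange : LinearMap.range T = ⊤ := by
    rw [LinearMap.range_comp, Submodule.range_mkQ, Submodule.map_top, LinearEquiv.range]
  have h := isOpen_setOf_map_inf_ker_mem (n := n) T q hW
  have hT : ∀ L : Submodule ℝ X, L.map T = ⊤ ↔ L ⊔ C = ⊤ := by
    intro L
    rw [← top_le_iff, ← hrange, ← Submodule.map_top, LinearMap.map_le_map_iff, hker, top_le_iff]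
  simp only [hker, hT] at h
  exact h

end Topology

end SympLin

namespace SympLin

/-! ### Preimages of the Sabot generators. -/

section Continuity

variable {X : Type*} [AddCommGroup X] [Module ℝ X]
  {ω : LinearMap.BilinForm ℝ X} {C : Submodule ℝ X}

theorem mem_sublevel_iff (p r : IndexedLagrangian ω) :
    r ∈ sublevel p ↔ (lagrangianDist p.lagr r.lagr : ℤ) ≤ (p.index : ℤ) - (r.index : ℤ) :=
  Iff.rfl

variable [FiniteDimensional ℝ X]

/-- The reduction is continuous on the open set of Lagrangian subspaces transverse to `C`. -/
theorem isOpen_setOf_lagrangianReduction_mem (hω : IsSymplectic ω) (hC : IsCoisotropic ω C)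
    {V : Set (LagrangianGrassmannian (reducedForm hω C))} (hV : IsOpen V) :
    IsOpen {L : LagrangianGrassmannian ω |
      L.1 ⊓ ω.orthogonal C = ⊥ ∧ lagrangianReduction hω hC L ∈ V} := by
  obtain ⟨q, hq⟩ := exists_extension_mkQ ω C
  obtain ⟨W, hW, rfl⟩ := hV
  refine ⟨_, isOpen_setOf_map_inf_mem C q hW, ?_⟩
  ext L
  have h1 : L.1 ⊓ C ⊓ LinearMap.ker q = L.1 ⊓ ω.orthogonal C := by
    rw [inf_ker_eq_inf_orthogonal hq inf_le_right, inf_assoc, inf_eq_right.2 hC]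
  change (L.1 ⊔ C = ⊤ ∧ L.1 ⊓ C ⊓ LinearMap.ker q = ⊥ ∧ (L.1 ⊓ C).map q ∈ W) ↔
    (L.1 ⊓ ω.orthogonal C = ⊥ ∧ reduceSubspace ω C L.1 ∈ W)
  -- For Lagrangian `L`, transversality to `C` and injectivity of `q` on `L ∩ C` are the same
  -- condition.
  rw [L.2.sup_eq_top_iff hω, h1, reduceSubspace_eq_map hq, ← and_assoc, and_self]

/-- The preimage of a generator `S(V × {k})` of the Sabot topology is `S(U × {k})`, where `U` is
the set of Lagrangian subspaces transverse to `C` whose reduction is in `V`. -/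
theorem preimage_indexedReduction_iUnion_sublevel (hω : IsSymplectic ω)
    (hC : IsCoisotropic ω C) (V : Set (LagrangianGrassmannian (reducedForm hω C))) (k : ℕ) :
    indexedReduction hω hC ⁻¹' (⋃ M ∈ V, sublevel ⟨M, k⟩) =
      ⋃ L ∈ {L : LagrangianGrassmannian ω |
        L.1 ⊓ ω.orthogonal C = ⊥ ∧ lagrangianReduction hω hC L ∈ V}, sublevel ⟨L, k⟩ := by
  ext ⟨L, j⟩
  simp only [Set.mem_preimage, Set.mem_iUnion, mem_sublevel_iff, exists_prop]
  constructor
  · rintro ⟨M, hMV, hM⟩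
    -- The excess in the lifting bound is exactly the index shift of the reduction, so the lift
    -- works at the same level `k`.
    obtain ⟨L₁, hL₁, h1, h2, h3⟩ := exists_lift_lagrangianDist_le hω hC L.2 M.2
    refine ⟨⟨L₁, hL₁⟩, ⟨h1, ?_⟩, ?_⟩
    · have : lagrangianReduction hω hC ⟨L₁, hL₁⟩ = M := Subtype.ext h2
      rwa [this]
    · change (lagrangianDist M (lagrangianReduction hω hC L) : ℤ) ≤
        k - ((j + excess ω C L.1 : ℕ) : ℤ) at hM
      change lagrangianDist ⟨L₁, hL₁⟩ L ≤
        lagrangianDist M (lagrangianReduction hω hC L) + excess ω C L.1 at h3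
      omega
  · rintro ⟨L₁, ⟨h1, hV⟩, h2⟩
    refine ⟨_, hV, ?_⟩
    have h3 := lagrangianDist_reduction_add_excess_le hω hC L₁ L
    have h4 : excess ω C L₁.1 = 0 := by rw [excess, h1, Module.finrank_zero_of_subsingleton]
    change (lagrangianDist (lagrangianReduction hω hC L₁) (lagrangianReduction hω hC L) : ℤ) ≤
      k - ((j + excess ω C L.1 : ℕ) : ℤ)
    change (lagrangianDist L₁ L : ℤ) ≤ k - j at h2
    omega

end Continuity

end SympLin

theorem mainTheorem9 {X : Type*} [AddCommGroup X] [Module ℝ X] [FiniteDimensional ℝ X]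
    (ω : LinearMap.BilinForm ℝ X) (hω : SympLin.IsSymplectic ω)
    (C : Submodule ℝ X) (hC : SympLin.IsCoisotropic ω C) :
    Continuous (SympLin.indexedReduction hω hC) := by
  refine continuous_generateFrom_iff.2 ?_
  rintro _ ⟨k, V, hV, rfl⟩
  rw [SympLin.preimage_indexedReduction_iUnion_sublevel]
  exact TopologicalSpace.isOpen_generateFrom_of_mem
    ⟨k, _, SympLin.isOpen_setOf_lagrangianReduction_mem hω hC hV, rfl⟩
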